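/- Let $X$ be a real Hilbert space (finite- or infinite-dimensional) with inner product $\langle\cdot,\cdot\rangle$. A closed halfspace is a set $\{x\in X : \langle a,x\rangle\le\beta\}$ with $a\in X\setminus\{0\}$ and $\beta\in\mathbb{R}$; a polyhedral set is the intersection of finitely many closed halfspaces (the empty intersection being $X$). For a nonempty closed convex set $C\subseteq X$, let $P_C$ denote the map sending each $x\in X$ to its unique nearest point in $C$. Let $\mathcal{C}$ be a nonempty finite collection of nonempty polyhedral subsets of $X$, let $\lambda\in[0,2)$ and $x_0\in X$. Let $(x_n)_{n\in\mathbb{N}}$ be any sequence in $X$ starting at $x_0$ such that for every $n\in\mathbb{N}$ there are $C_n\in\mathcal{C}$ and $\mu_n\in[0,\lambda]$ with $$x_{n+1}=(1-\mu_n)x_n+\mu_n P_{C_n}x_n.$$ Then the sequence $(x_n)_{n\in\mathbb{N}}$ is bounded. -/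

import Mathlib

namespace RelaxedProjections

variable {X : Type*} [NormedAddCommGroup X] [InnerProductSpace ℝ X]

/-- A closed halfspace of `X`: a set `{x | ⟪a, x⟫ ≤ β}` with `a ≠ 0` and `β` real. -/
def IsClosedHalfspace (H : Set X) : Prop :=
  ∃ a : X, a ≠ 0 ∧ ∃ β : ℝ, H = {x : X | inner ℝ a x ≤ β}

/-- A polyhedral set: the intersection of finitely many closed halfspaces
(the empty intersection being the whole space). -/
def IsPolyhedral (C : Set X) : Prop :=
  ∃ S : Set (Set X), S.Finite ∧ (∀ H ∈ S, IsClosedHalfspace H) ∧ C = ⋂₀ S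

/-- `p` is a nearest point of `C` to `x`. -/
def IsNearestPoint (C : Set X) (x p : X) : Prop :=
  p ∈ C ∧ ∀ y ∈ C, ‖x - p‖ ≤ ‖x - y‖

/-- The projector `P_C`: it maps `x` to its nearest point in `C`. The nearest point exists and is
unique when `C` is a nonempty closed convex subset of a Hilbert space, see
`existsUnique_isNearestPoint` and `projector_eq_iff`. -/
noncomputable def projector (C : Set X) (x : X) : X :=
  Classical.epsilon fun p : X => IsNearestPoint C x p

/-- The set of relaxed projectors `(1 - μ) Id + μ P_C` with `C ∈ 𝒞` and `μ ∈ Λ`. -/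
def relaxedProjectors (𝒞 : Set (Set X)) (Λ : Set ℝ) : Set (X → X) :=
  {R | ∃ C ∈ 𝒞, ∃ μ ∈ Λ, R = fun x => (1 - μ) • x + μ • projector C x}

theorem IsPolyhedral.isClosed {C : Set X} (h : IsPolyhedral C) : IsClosed C := by
  obtain ⟨S, -, hS, rfl⟩ := h
  refine isClosed_sInter fun H hH => ?_
  obtain ⟨a, -, β, rfl⟩ := hS H hH
  exact isClosed_le (by fun_prop) continuous_const

theorem IsPolyhedral.convex {C : Set X} (h : IsPolyhedral C) : Convex ℝ C := by
  obtain ⟨S, -, hS, rfl⟩ := h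
  refine convex_sInter fun H hH => ?_
  obtain ⟨a, -, β, rfl⟩ := hS H hH
  exact convex_halfSpace_le (innerₗ X a).isLinear β

theorem isNearestPoint_iff_inner {C : Set X} (hc : Convex ℝ C) {x p : X} :
    IsNearestPoint C x p ↔ p ∈ C ∧ ∀ w ∈ C, inner ℝ (x - p) (w - p) ≤ 0 := by
  refine and_congr_right fun hp => ?_
  rw [← norm_eq_iInf_iff_real_inner_le_zero hc hp]
  have : Nonempty C := ⟨⟨p, hp⟩⟩
  have hb : BddBelow (Set.range fun w : C => ‖x - w‖) :=
    ⟨0, Set.forall_mem_range.2 fun _ => norm_nonneg _⟩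
  constructor
  · intro h
    exact le_antisymm (le_ciInf fun w => h w w.2) (ciInf_le hb ⟨p, hp⟩)
  · intro h y hy
    rw [h]
    exact ciInf_le hb ⟨y, hy⟩

theorem existsUnique_isNearestPoint [CompleteSpace X] {C : Set X} (hne : C.Nonempty)
    (hcl : IsClosed C) (hc : Convex ℝ C) (x : X) : ∃! p, IsNearestPoint C x p := by
  obtain ⟨p, hp, h⟩ := exists_norm_eq_iInf_of_complete_convex hne hcl.isComplete hc x
  refine ⟨p, (isNearestPoint_iff_inner hc).2
    ⟨hp, (norm_eq_iInf_iff_real_inner_le_zero hc hp).1 h⟩, fun q hq => ?_⟩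
  have h1 := (norm_eq_iInf_iff_real_inner_le_zero hc hp).1 h q hq.1
  have h2 := ((isNearestPoint_iff_inner hc).1 hq).2 p hp
  have h3 : inner ℝ (q - p) (q - p) ≤ 0 := by
    have e : inner ℝ (q - p) (q - p) = inner ℝ (x - p) (q - p) + inner ℝ (x - q) (p - q) := by
      rw [← neg_sub q p, inner_neg_right, ← sub_eq_add_neg, ← inner_sub_left]
      congr 1
      abel
    linarith
  rw [real_inner_self_eq_norm_sq] at h3
  exact sub_eq_zero.1 (norm_eq_zero.1 (pow_eq_zero_iff two_ne_zero |>.1 (le_antisymm h3 (sq_nonneg _))))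

theorem projector_eq_iff [CompleteSpace X] {C : Set X} (hne : C.Nonempty)
    (hcl : IsClosed C) (hc : Convex ℝ C) (x p : X) :
    projector C x = p ↔ IsNearestPoint C x p := by
  have hu := existsUnique_isNearestPoint hne hcl hc x
  have hs : IsNearestPoint C x (projector C x) := Classical.epsilon_spec hu.exists
  exact ⟨fun h => h ▸ hs, fun h => hu.unique hs h⟩

end RelaxedProjections

/-! Projecting x onto a polyhedron amounts to projecting onto the affine subspace of the constraints
active at the nearest point, so only finitely many affine subspaces, with finite-dimensional normal
spaces, occur (`sub_mem_span_of_isNearestPoint`). Relaxed steps are nonexpansive, so the start 0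
suffices; its orbits stay in the finite-dimensional sum V of the normal spaces.

Induct on the family. Far out near a unit direction u of V, the steps with normal space orthogonal
to u come from a proper subfamily, bounded by induction; every other step lowers the norm in
proportion to its length. So an excursion above its initial norm gains only a bounded amount
(`exists_excursion_bound_near`). Compactness of the unit sphere of V makes this uniform, and
restarting whenever the norm falls back bounds the orbit. -/

namespace RelaxedProjections

open Filter Topology

section AffineSteps

variable {X : Type*} [NormedAddCommGroup X] [InnerProductSpace ℝ X]

/-! ### Estimates for a single relaxed step. -/

section Projection

variable (W : Submodule ℝ X) [W.HasOrthogonalProjection]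

theorem inner_starProjection_right_eq (x y : X) :
    inner ℝ x (W.starProjection y) = inner ℝ (W.starProjection x) (W.starProjection y) := by
  rw [← Submodule.inner_starProjection_left_eq_right,
    Submodule.inner_starProjection_left_eq_right,
    Submodule.inner_starProjection_left_eq_right]
  congr 1
  exact (Submodule.starProjection_eq_self_iff.2 (W.starProjection_apply_mem y)).symm

/-- The component in `W` is scaled by 1 - μ, of modulus at most 1; the orthogonal component is
unchanged. -/
theorem norm_sub_smul_starProjection_le {μ : ℝ} (h0 : 0 ≤ μ) (h2 : μ ≤ 2) (v : X) :
    ‖v - μ • W.starProjection v‖ ≤ ‖v‖ := by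
  refine (sq_le_sq₀ (norm_nonneg _) (norm_nonneg _)).1 ?_
  rw [norm_sub_sq_real, inner_smul_right, inner_starProjection_right_eq,
    real_inner_self_eq_norm_sq, norm_smul, Real.norm_of_nonneg h0]
  nlinarith [mul_nonneg (mul_nonneg h0 (sub_nonneg.2 h2)) (sq_nonneg ‖W.starProjection v‖)]

/-- A relaxed step that moves by `μ • g` towards the affine subspace `{z | W.starProjection z = b}`
decreases the norm by an amount proportional to its length, as soon as `g` is large. -/
theorem norm_sq_sub_smul_le {μ lam : ℝ} (h0 : 0 ≤ μ) (hl : μ ≤ lam) {b : X} (hb : b ∈ W)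
    (y g : X) (hg : g = W.starProjection y - b) :
    ‖y - μ • g‖ ^ 2 ≤ ‖y‖ ^ 2 - μ * ‖g‖ * ((2 - lam) * ‖g‖ - 2 * ‖b‖) := by
  have hgW : W.starProjection g = g :=
    Submodule.starProjection_eq_self_iff.2 (hg ▸ W.sub_mem (W.starProjection_apply_mem y) hb)
  have h1 : inner ℝ y g = ‖g‖ ^ 2 + inner ℝ b g := by
    have : inner ℝ y g = inner ℝ (W.starProjection y) g := by
      conv_lhs => rw [← hgW]
      rw [inner_starProjection_right_eq, hgW]
    rw [this, ← real_inner_self_eq_norm_sq, ← inner_add_left]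
    congr 1
    rw [hg]; abel
  have h2 : -(‖b‖ * ‖g‖) ≤ inner ℝ b g := neg_le_of_abs_le (abs_real_inner_le_norm b g)
  rw [norm_sub_sq_real, inner_smul_right, h1, norm_smul, Real.norm_of_nonneg h0]
  nlinarith [mul_le_mul_of_nonneg_left h2 h0,
    mul_nonneg (mul_nonneg h0 (sub_nonneg.2 hl)) (sq_nonneg ‖g‖)]

/-- At a point far out in a direction close to `u`, where `W.starProjection u ≠ 0`, the direction
`-g` of a relaxed step makes an angle with `u` bounded away from the right angle. -/
theorem far_step_estimates {u b y g : X} {η R : ℝ} (hu : ‖u‖ = 1) (hη : 0 ≤ η) (hη3 : η ≤ 1 / 3)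
    (hR : 0 ≤ R) (hq : 8 * η ≤ ‖W.starProjection u‖ ^ 2) (hb : ‖b‖ ≤ η * R)
    (hy : ‖y - R • u‖ ≤ 2 * η * R) (hg : g = W.starProjection y - b) :
    5 * η * R ≤ inner ℝ u g ∧ 2 * η * ‖g‖ ≤ inner ℝ u g := by
  have hg1 : 5 * η * R ≤ inner ℝ u g := by
    have e : g = R • W.starProjection u + W.starProjection (y - R • u) - b := by
      rw [hg, map_sub, map_smul]; abel
    have h1 := neg_le_of_abs_le (abs_real_inner_le_norm u (W.starProjection (y - R • u)))
    have h2 := W.norm_starProjection_apply_le (y - R • u)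
    have h3 := real_inner_le_norm u b
    rw [hu, one_mul] at h1 h3
    rw [e, inner_sub_right, inner_add_right, inner_smul_right,
      inner_starProjection_right_eq W u u, real_inner_self_eq_norm_sq]
    -- The main term is at least 8ηR; the deviation of y costs at most 2ηR and b at most ηR.
    linarith [mul_le_mul_of_nonneg_left hq hR]
  have hg2 : ‖g‖ ≤ 2 * R := by
    have h1 := norm_sub_le (W.starProjection y) b
    have h2 := W.norm_starProjection_apply_le y
    have h3 := norm_add_le (R • u) (y - R • u)
    rw [add_sub_cancel, norm_smul, hu, mul_one, Real.norm_of_nonneg hR] at h3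
    rw [hg]
    linarith [mul_le_mul_of_nonneg_right hη3 hR]
  exact ⟨hg1, by linarith [mul_le_mul_of_nonneg_left hg2 hη, mul_nonneg hη hR]⟩

end Projection

/-! ### Orbits of relaxed projections onto affine subspaces. -/

variable {ι : Type*} (W : ι → Submodule ℝ X) [∀ i, FiniteDimensional ℝ (W i)] (b : ι → X)
  (lam : ℝ)

/-- One relaxed projection step, with relaxation parameter in `[0, lam]`, towards one of the affine
subspaces `{z | (W i).starProjection z = b i}` with `i ∈ s`. -/
def AffineStep (s : Finset ι) (x y : X) : Prop :=
  ∃ i ∈ s, ∃ μ ∈ Set.Icc 0 lam, y = x - μ • ((W i).starProjection x - b i)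

variable {W b lam}

theorem norm_le_add_of_affineStep {s : Finset ι} (hlam : lam < 2) {x y : X}
    (h : AffineStep W b lam s x y) : ‖y‖ ≤ ‖x‖ + 2 * ∑ i ∈ s, ‖b i‖ := by
  obtain ⟨i, hi, μ, ⟨h0, hl⟩, rfl⟩ := h
  have h1 := norm_sub_smul_starProjection_le (W i) h0 (hl.trans hlam.le) x
  have h2 : ‖b i‖ ≤ ∑ i ∈ s, ‖b i‖ :=
    Finset.single_le_sum (f := fun i => ‖b i‖) (fun _ _ => norm_nonneg _) hi
  have h3 : x - μ • ((W i).starProjection x - b i) =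
      (x - μ • (W i).starProjection x) + μ • b i := by rw [smul_sub]; abel
  have h4 := norm_add_le (x - μ • (W i).starProjection x) (μ • b i)
  rw [norm_smul, Real.norm_of_nonneg h0] at h4
  rw [h3]
  nlinarith [norm_nonneg (b i)]

/-- Run the same steps from `x'`: the `b i` cancel in the difference, which evolves by nonexpansive
linear maps. -/
theorem exists_reachable_norm_sub_le {s : Finset ι} (hlam : lam < 2) {x x' y : X}
    (h : Relation.ReflTransGen (AffineStep W b lam s) x y) :
    ∃ y', Relation.ReflTransGen (AffineStep W b lam s) x' y' ∧ ‖y - y'‖ ≤ ‖x - x'‖ := by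
  induction h with
  | refl => exact ⟨x', .refl, le_rfl⟩
  | @tail y z _ hyz ih =>
    obtain ⟨y', hy', hle⟩ := ih
    obtain ⟨i, hi, μ, hμ, rfl⟩ := hyz
    refine ⟨_, hy'.tail ⟨i, hi, μ, hμ, rfl⟩, le_trans ?_ hle⟩
    have e : y - μ • ((W i).starProjection y - b i) - (y' - μ • ((W i).starProjection y' - b i)) =
        (y - y') - μ • (W i).starProjection (y - y') := by
      rw [map_sub]; module
    rw [e]
    exact norm_sub_smul_starProjection_le (W i) hμ.1 (hμ.2.trans hlam.le) _

/-- If all steps that fix the direction `u` have bounded orbits, then so do the excursions above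
the initial norm that start far out in a direction close to `u`. -/
theorem exists_excursion_bound_near {s t : Finset ι} (hlam : lam < 2)
    (hb : ∀ i ∈ s, b i ∈ W i) {u : X} (hu : ‖u‖ = 1)
    (ht : ∀ i ∈ s, (W i).starProjection u = 0 → i ∈ t) {K : ℝ}
    (hK : ∀ y, Relation.ReflTransGen (AffineStep W b lam t) 0 y → ‖y‖ ≤ K) :
    ∃ η > 0, ∃ R₀ B : ℝ, ∀ x y : X, R₀ ≤ ‖x‖ → ‖x - ‖x‖ • u‖ ≤ η * ‖x‖ →
      Relation.ReflTransGen (fun p q => AffineStep W b lam s p q ∧ ‖x‖ < ‖q‖) x y →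
      ‖y‖ ≤ ‖x‖ + B := by
  obtain ⟨η, hη, hη3, hηq⟩ : ∃ η : ℝ, 0 < η ∧ η ≤ 1 / 3 ∧
      ∀ i ∈ s, (W i).starProjection u ≠ 0 → 8 * η ≤ ‖(W i).starProjection u‖ ^ 2 := by
    have key : ∀ c > (0 : ℝ), ∀ᶠ η in 𝓝[>] (0 : ℝ), η ≤ c := fun c hc =>
      (eventually_le_nhds hc).filter_mono nhdsWithin_le_nhds
    have h3 : ∀ᶠ η in 𝓝[>] (0 : ℝ), ∀ i ∈ s, (W i).starProjection u ≠ 0 →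
        8 * η ≤ ‖(W i).starProjection u‖ ^ 2 := by
      rw [Filter.eventually_all_finset]
      intro i _
      by_cases h : (W i).starProjection u = 0
      · simp [h]
      · filter_upwards [key (‖(W i).starProjection u‖ ^ 2 / 8) (by positivity)] with η hη _
        linarith
    obtain ⟨η, h⟩ := (eventually_mem_nhdsWithin.and
      ((key (1 / 3) (by norm_num)).and h3)).exists
    exact ⟨η, h.1, h.2.1, h.2.2⟩
  set A := ∑ i ∈ s, ‖b i‖ with hA
  have hbA : ∀ i ∈ s, ‖b i‖ ≤ A := fun i hi =>
    Finset.single_le_sum (f := fun i => ‖b i‖) (fun _ _ => norm_nonneg _) hi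
  have hK0 : 0 ≤ K := by simpa using hK 0 .refl
  obtain hlam0 | hlam0 := lt_or_ge lam 0
  · refine ⟨η, hη, 0, 0, fun x y _ _ h => ?_⟩
    induction h with
    | refl => simp
    | tail _ h _ =>
      obtain ⟨⟨i, _, μ, hμ, _⟩, _⟩ := h
      exact absurd (hμ.1.trans hμ.2) (not_le.2 hlam0)
  -- For R large, a step not fixing u of length ℓ will lower the squared norm by at least κRℓ.
  set κ := (2 - lam) * η with hκ
  have hκ0 : 0 < κ := mul_pos (sub_pos.2 hlam) hη
  have hκη : κ ≤ 2 * η := by nlinarith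
  -- M₀ caps the total length of such steps: the possible excess of the squared norm over R² is at
  -- most (2ηK + κ)R.
  obtain ⟨M₀, hM₀, hM₀0⟩ : ∃ M₀ : ℝ, κ * M₀ = 2 * η * K + κ ∧ 0 ≤ M₀ :=
    ⟨2 * η * K / κ + 1, by field_simp, by positivity⟩
  obtain ⟨R₀, hR₀⟩ : ∃ R₀ : ℝ, ∀ R ≥ R₀, 0 < R ∧ K + M₀ ≤ η * R ∧ A ≤ η * R ∧ A ≤ 2 * κ * R ∧
      (K + M₀) ^ 2 ≤ κ * R ∧ (K + M₀) ^ 2 ≤ R := by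
    have key : ∀ c > (0 : ℝ), ∀ C : ℝ, ∀ᶠ R in atTop, C ≤ c * R := fun c hc C =>
      (tendsto_id.const_mul_atTop hc).eventually_ge_atTop C
    exact eventually_atTop.1 ((eventually_gt_atTop 0).and <| (key η hη _).and <|
      (key η hη _).and <| (key (2 * κ) (by positivity) _).and <| (key κ hκ0 _).and <|
        eventually_ge_atTop _)
  refine ⟨η, hη, R₀, η * K + 1, fun x y hxR hxu hxy => ?_⟩
  obtain ⟨hR, hR1, hR2, hR3, hR4, hR5⟩ := hR₀ ‖x‖ hxR
  set R := ‖x‖ with hRdef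
  -- the norm bound that follows from the invariant
  have bound : ∀ (y y' : X) (M : ℝ), 0 ≤ M → M ≤ M₀ → ‖y'‖ ≤ K →
      ‖y - R • u - y'‖ ≤ ‖x - R • u‖ + M →
      inner ℝ u (y - R • u) ≤ inner ℝ u (x - R • u) - 2 * η * M →
      ‖y - R • u‖ ≤ 2 * η * R ∧
      ‖y‖ ^ 2 ≤ R ^ 2 - 2 * η * R * M + 2 * η * R * K + (K + M₀) ^ 2 := by
    intro y y' M hM hMM hy' hd hi
    have h1 : ‖y - R • u‖ ≤ ‖x - R • u‖ + M + K := by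
      have := norm_add_le (y - R • u - y') y'
      rw [sub_add_cancel] at this
      linarith
    refine ⟨by linarith, ?_⟩
    have expand : ∀ z : X, ‖z‖ ^ 2 = R ^ 2 + 2 * (R * inner ℝ u (z - R • u)) + ‖z - R • u‖ ^ 2 := by
      intro z
      have := norm_add_sq_real (R • u) (z - R • u)
      rwa [add_sub_cancel, norm_smul, hu, mul_one, Real.norm_of_nonneg hR.le,
        real_inner_smul_left] at this
    have hy2 := expand y
    have hx2 := expand x
    rw [← hRdef] at hx2
    -- The cross term is at most 2ηR(M + K), while the drop along u contributes -4ηRM; a margin of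
    -- -2ηRM remains.
    have h2 : ‖y - R • u‖ ^ 2 ≤ (‖x - R • u‖ + (M + K)) ^ 2 :=
      pow_le_pow_left₀ (norm_nonneg _) (by linarith) 2
    have h3 : (M + K) ^ 2 ≤ (K + M₀) ^ 2 := pow_le_pow_left₀ (by positivity) (by linarith) 2
    have h4 := mul_le_mul_of_nonneg_left hi hR.le
    have h5 := mul_le_mul_of_nonneg_right hxu (add_nonneg hM hK0)
    linarith
  -- M is the total length of the steps not fixing u; y' is the orbit of 0 driven by the steps that
  -- do fix u.
  obtain ⟨M, y', hM, hMM, hy', hd, hi⟩ : ∃ (M : ℝ) (y' : X), 0 ≤ M ∧ M ≤ M₀ ∧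
      Relation.ReflTransGen (AffineStep W b lam t) 0 y' ∧
      ‖y - R • u - y'‖ ≤ ‖x - R • u‖ + M ∧
      inner ℝ u (y - R • u) ≤ inner ℝ u (x - R • u) - 2 * η * M := by
    induction hxy with
    | refl => exact ⟨0, 0, le_rfl, hM₀0, .refl, by simp, by simp⟩
    | @tail y z _ hyz ih =>
      obtain ⟨M, y', hM, hMM, hy', hd, hi⟩ := ih
      obtain ⟨⟨i, his, μ, ⟨hμ0, hμl⟩, rfl⟩, hnorm⟩ := hyz
      obtain ⟨hw, hy2⟩ := bound y y' M hM hMM (hK y' hy') hd hi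
      by_cases hiu : (W i).starProjection u = 0
      · refine ⟨M, _, hM, hMM, hy'.tail ⟨i, ht i his hiu, μ, ⟨hμ0, hμl⟩, rfl⟩, ?_, ?_⟩
        · have e : y - μ • ((W i).starProjection y - b i) - R • u -
              (y' - μ • ((W i).starProjection y' - b i)) =
              (y - R • u - y') - μ • (W i).starProjection (y - R • u - y') := by
            simp only [map_sub, map_smul, hiu]; module
          rw [e]
          exact (norm_sub_smul_starProjection_le (W i) hμ0 (hμl.trans hlam.le) _).trans hd
        · have e : inner ℝ u ((W i).starProjection y - b i) = 0 := by
            have hm : (W i).starProjection y - b i ∈ W i :=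
              (W i).sub_mem ((W i).starProjection_apply_mem y) (hb i his)
            rw [← Submodule.starProjection_eq_self_iff.2 hm, inner_starProjection_right_eq, hiu,
              inner_zero_left]
          rw [sub_right_comm, inner_sub_right, inner_smul_right, e, mul_zero, sub_zero]
          exact hi
      · have hq := hηq i his hiu
        have hbi := hbA i his
        set g := (W i).starProjection y - b i with hg
        obtain ⟨hg1, hgu⟩ := far_step_estimates (W i) hu hη.le hη3 hR.le hq
          ((hbA i his).trans hR2) hw hg
        have hg3 : inner ℝ u g ≤ ‖g‖ := by simpa [hu] using real_inner_le_norm u g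
        have hdrop := norm_sq_sub_smul_le (W i) hμ0 hμl (hb i his) y g hg
        have hs0 : 0 ≤ μ * ‖g‖ := by positivity
        have hκR : κ * R ≤ (2 - lam) * ‖g‖ - 2 * ‖b i‖ := by
          have h1 := mul_le_mul_of_nonneg_left (hg1.trans hg3) (sub_pos.2 hlam).le
          have h2 : (2 - lam) * (5 * η * R) = 5 * (κ * R) := by rw [hκ]; ring
          linarith
        have hdrop' := mul_le_mul_of_nonneg_left hκR hs0
        have hnorm2 : R ^ 2 < ‖y - μ • g‖ ^ 2 := pow_lt_pow_left₀ hnorm hR.le two_ne_zero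
        -- The norm is still above R after this step, so the accumulated drop cannot exceed the
        -- available excess.
        have hsum : M + μ * ‖g‖ ≤ M₀ := by
          have h1 : R * (κ * (M + μ * ‖g‖)) ≤ R * (κ * M₀) := by
            rw [hM₀]
            linarith [mul_le_mul_of_nonneg_right hκη (mul_nonneg hR.le hM)]
          exact le_of_mul_le_mul_left (le_of_mul_le_mul_left h1 hR) hκ0
        refine ⟨M + μ * ‖g‖, y', by positivity, hsum, hy', ?_, ?_⟩
        · have e : y - μ • g - R • u - y' = (y - R • u - y') - μ • g := by abel
          have h1 := norm_sub_le (y - R • u - y') (μ • g)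
          rw [norm_smul, Real.norm_of_nonneg hμ0] at h1
          rw [e]
          linarith
        · rw [sub_right_comm, inner_sub_right, inner_smul_right]
          linarith [mul_le_mul_of_nonneg_left hgu hμ0]
  obtain ⟨-, hy2⟩ := bound y y' M hM hMM (hK y' hy') hd hi
  refine (sq_le_sq₀ (norm_nonneg _) (by positivity)).1 ?_
  linarith [sq_nonneg (η * K + 1), mul_nonneg (mul_nonneg hη.le hR.le) hM,
    (by ring : (R + (η * K + 1)) ^ 2 = R ^ 2 + 2 * (η * R * K) + 2 * R + (η * K + 1) ^ 2)]

/-- Otherwise u would be orthogonal to the sum containing it. This makes the subfamily fixing u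
proper, as the induction needs. -/
theorem exists_starProjection_ne_zero {s : Finset ι} {u : X} (hu : u ∈ s.sup W) (hu0 : u ≠ 0) :
    ∃ i ∈ s, (W i).starProjection u ≠ 0 := by
  by_contra! h
  have hle : s.sup W ≤ (ℝ ∙ u)ᗮ := by
    refine Finset.sup_le fun i hi v hv => ?_
    rw [Submodule.mem_orthogonal_singleton_iff_inner_right,
      ← Submodule.starProjection_eq_self_iff.2 hv, inner_starProjection_right_eq, h i hi,
      inner_zero_left]
  exact hu0 (inner_self_eq_zero.1 (Submodule.mem_orthogonal_singleton_iff_inner_right.1 (hle hu)))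

/-- The orbits of the origin under finitely many families of relaxed projections onto affine
subspaces of finite codimension are uniformly bounded. -/
theorem exists_norm_le_of_reachable_zero (hlam : lam < 2) (s : Finset ι)
    (hb : ∀ i ∈ s, b i ∈ W i) :
    ∃ K, ∀ y, Relation.ReflTransGen (AffineStep W b lam s) 0 y → ‖y‖ ≤ K := by
  classical
  induction s using Finset.strongInduction with
  | H s ih =>
  set V := s.sup W with hV
  have : FiniteDimensional ℝ V := Submodule.finiteDimensional_finset_sup s W
  have hcomp : IsCompact ((↑) '' Metric.sphere (0 : V) 1 : Set X) :=
    (isCompact_sphere _ _).image continuous_subtype_val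
  obtain ⟨R₀, B, hRB⟩ : ∃ R₀ B : ℝ, ∀ x y : X, R₀ ≤ ‖x‖ →
      (∃ v ∈ ((↑) '' Metric.sphere (0 : V) 1 : Set X), x = ‖x‖ • v) →
      Relation.ReflTransGen (fun p q => AffineStep W b lam s p q ∧ ‖x‖ < ‖q‖) x y →
      ‖y‖ ≤ ‖x‖ + B := by
    refine hcomp.induction_on (p := fun S => ∃ R₀ B : ℝ, ∀ x y : X, R₀ ≤ ‖x‖ →
      (∃ v ∈ S, x = ‖x‖ • v) →
      Relation.ReflTransGen (fun p q => AffineStep W b lam s p q ∧ ‖x‖ < ‖q‖) x y →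
      ‖y‖ ≤ ‖x‖ + B) ?_ ?_ ?_ ?_
    · exact ⟨0, 0, by simp⟩
    · rintro S T hST ⟨R₀, B, h⟩
      exact ⟨R₀, B, fun x y hx ⟨v, hv, e⟩ => h x y hx ⟨v, hST hv, e⟩⟩
    · rintro S T ⟨R₁, B₁, h₁⟩ ⟨R₂, B₂, h₂⟩
      refine ⟨max R₁ R₂, max B₁ B₂, fun x y hx ⟨v, hv, e⟩ hxy => ?_⟩
      rcases hv with hv | hv
      · exact (h₁ x y ((le_max_left _ _).trans hx) ⟨v, hv, e⟩ hxy).trans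
          (by gcongr; exact le_max_left _ _)
      · exact (h₂ x y ((le_max_right _ _).trans hx) ⟨v, hv, e⟩ hxy).trans
          (by gcongr; exact le_max_right _ _)
    · rintro _ ⟨u, hu, rfl⟩
      have hu1 : ‖(u : X)‖ = 1 := by simpa using hu
      obtain ⟨i, his, hi⟩ := exists_starProjection_ne_zero u.2 (norm_ne_zero_iff.1 (by simp [hu1]))
      obtain ⟨K, hK⟩ := ih (s.filter fun i => (W i).starProjection (u : X) = 0)
        (Finset.filter_ssubset.2 ⟨i, his, hi⟩) fun j hj => hb j (Finset.mem_filter.1 hj).1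
      obtain ⟨η, hη, R₀, B, h⟩ := exists_excursion_bound_near hlam hb hu1
        (fun i hi h => Finset.mem_filter.2 ⟨hi, h⟩) hK
      refine ⟨Metric.ball (u : X) η, mem_nhdsWithin_of_mem_nhds (Metric.ball_mem_nhds _ hη),
        R₀, B, fun x y hx ⟨v, hv, e⟩ => h x y hx ?_⟩
      have e' : x - ‖x‖ • (u : X) = ‖x‖ • (v - u) := by rw [smul_sub, ← e]
      rw [e', norm_smul, norm_norm, mul_comm]
      exact mul_le_mul_of_nonneg_right (mem_ball_iff_norm.1 hv).le (norm_nonneg _)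
  have hstepV : ∀ p q, AffineStep W b lam s p q → p ∈ V → q ∈ V := by
    rintro p _ ⟨i, hi, μ, _, rfl⟩ hp
    exact V.sub_mem hp (V.smul_mem _ (Finset.le_sup (f := W) hi
      ((W i).sub_mem ((W i).starProjection_apply_mem p) (hb i hi))))
  set D := 2 * ∑ i ∈ s, ‖b i‖ with hD
  have hD0 : 0 ≤ D := by positivity
  -- The 1 keeps excursion starting points nonzero, so that they can be normalised.
  set R₁ := max R₀ 1 with hR₁
  have hR₁0 : 1 ≤ R₁ := le_max_right _ _
  -- every reachable point lies on an excursion from a point of controlled norm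
  have inv : ∀ y, Relation.ReflTransGen (AffineStep W b lam s) 0 y → y ∈ V ∧ ∃ z ∈ V,
      ‖z‖ ≤ R₁ + D ∧ (y = z ∨ R₁ ≤ ‖z‖ ∧
        Relation.ReflTransGen (fun p q => AffineStep W b lam s p q ∧ ‖z‖ < ‖q‖) z y) := by
    intro y hy
    induction hy with
    | refl => exact ⟨V.zero_mem, 0, V.zero_mem, by simp; positivity, .inl rfl⟩
    | @tail y y' _ hyy' ih =>
      obtain ⟨hyV, z, hzV, hz, h⟩ := ih
      have hyV' := hstepV _ _ hyy' hyV
      refine ⟨hyV', ?_⟩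
      by_cases hzR : R₁ ≤ ‖z‖
      · have h' : Relation.ReflTransGen
            (fun p q => AffineStep W b lam s p q ∧ ‖z‖ < ‖q‖) z y := by
          rcases h with rfl | h
          · exact .refl
          · exact h.2
        by_cases hlt : ‖z‖ < ‖y'‖
        · exact ⟨z, hzV, hz, .inr ⟨hzR, h'.tail ⟨hyy', hlt⟩⟩⟩
        -- The norm has fallen back: a new excursion starts at y', no farther out than z.
        · exact ⟨y', hyV', (not_lt.1 hlt).trans hz, .inl rfl⟩
      · obtain rfl : y = z := h.resolve_right fun h => hzR h.1
        have := norm_le_add_of_affineStep hlam hyy'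
        exact ⟨y', hyV', by linarith, .inl rfl⟩
  refine ⟨R₁ + D + max B 0, fun y hy => ?_⟩
  obtain ⟨-, z, hzV, hz, rfl | ⟨hzR, h⟩⟩ := inv y hy
  · exact hz.trans (le_add_of_nonneg_right (le_max_right _ _))
  · have hz0 : ‖z‖ ≠ 0 := by linarith
    have := hRB z y ((le_max_left _ _).trans hzR)
      ⟨‖z‖⁻¹ • z, ⟨⟨‖z‖⁻¹ • z, V.smul_mem _ hzV⟩, by simp [norm_smul, hz0], rfl⟩,
        by rw [smul_inv_smul₀ hz0]⟩ h
    linarith [le_max_left B 0]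

theorem exists_norm_le_of_reachable (hlam : lam < 2) (s : Finset ι)
    (hb : ∀ i ∈ s, b i ∈ W i) (x : X) :
    ∃ K, ∀ y, Relation.ReflTransGen (AffineStep W b lam s) x y → ‖y‖ ≤ K := by
  obtain ⟨K, hK⟩ := exists_norm_le_of_reachable_zero hlam s hb
  refine ⟨‖x‖ + K, fun y hy => ?_⟩
  obtain ⟨y', hy', hle⟩ := exists_reachable_norm_sub_le (x' := 0) hlam hy
  have := norm_add_le (y - y') y'
  rw [sub_add_cancel] at this
  rw [sub_zero] at hle
  linarith [hK y' hy']

end AffineSteps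

/-! ### Active constraints of a polyhedron. -/

section Polyhedral

variable {X : Type*} [NormedAddCommGroup X] [InnerProductSpace ℝ X]

/-- If `p` is the nearest point to `x` of the polyhedron cut out by `⟪a j, ·⟫ ≤ β j`, then `x - p`
lies in the span of the normals of the constraints that are active at `p`. -/
theorem sub_mem_span_of_isNearestPoint {J : Type*} (S : Finset J) (a : J → X) (β : J → ℝ)
    {x p : X} (h : IsNearestPoint {z | ∀ j ∈ S, inner ℝ (a j) z ≤ β j} x p) :
    x - p ∈ Submodule.span ℝ (a '' {j | j ∈ S ∧ inner ℝ (a j) p = β j}) := by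
  set C := {z | ∀ j ∈ S, inner ℝ (a j) z ≤ β j} with hC
  set N := Submodule.span ℝ (a '' {j | j ∈ S ∧ inner ℝ (a j) p = β j}) with hN
  have hconv : Convex ℝ C := by
    have : C = ⋂ j ∈ S, {z | inner ℝ (a j) z ≤ β j} := by ext; simp [hC]
    rw [this]
    exact convex_iInter₂ fun j _ => convex_halfSpace_le (innerₗ X (a j)).isLinear (β j)
  have : FiniteDimensional ℝ N := FiniteDimensional.span_of_finite ℝ
    ((S.finite_toSet.subset fun j hj => hj.1).image a)
  obtain ⟨hp, hin⟩ := (isNearestPoint_iff_inner hconv).1 h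
  rw [← Submodule.orthogonal_orthogonal N, Submodule.mem_orthogonal']
  -- A small move from p along v keeps active constraints tight and inactive ones slack, so it stays
  -- in C. Applying this to -v as well gives orthogonality.
  have key : ∀ v ∈ Nᗮ, inner ℝ (x - p) v ≤ 0 := by
    intro v hv
    have hev : ∀ᶠ t : ℝ in 𝓝[>] 0, p + t • v ∈ C := by
      simp only [hC, Set.mem_ofPred_eq]
      rw [Filter.eventually_all_finset]
      intro j hj
      rcases (hp j hj).eq_or_lt with he | hlt
      · have h0 : inner ℝ (a j) v = 0 :=
          (Submodule.mem_orthogonal N v).1 hv _ (Submodule.subset_span ⟨j, ⟨hj, he⟩, rfl⟩)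
        exact .of_forall fun t => by rw [inner_add_right, inner_smul_right, h0]; simp [he]
      · have hc : ContinuousAt (fun t : ℝ => inner ℝ (a j) (p + t • v)) 0 := by fun_prop
        exact ((hc.eventually_lt_const (by simpa using hlt)).filter_mono
          nhdsWithin_le_nhds).mono fun _ h => h.le
    obtain ⟨t, ht0, ht⟩ := (eventually_mem_nhdsWithin.and hev).exists
    have := hin _ ht
    rw [add_sub_cancel_left, inner_smul_right] at this
    exact nonpos_of_mul_nonpos_right this ht0
  intro v hv
  refine le_antisymm (key v hv) ?_
  have := key (-v) (Nᗮ.neg_mem hv)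
  rw [inner_neg_right] at this
  linarith

theorem starProjection_span_eq {J : Type*} (I : Set J) (a : J → X)
    [FiniteDimensional ℝ (Submodule.span ℝ (a '' I))] {p q : X}
    (h : ∀ j ∈ I, inner ℝ (a j) p = inner ℝ (a j) q) :
    (Submodule.span ℝ (a '' I)).starProjection p =
      (Submodule.span ℝ (a '' I)).starProjection q := by
  have hle : Submodule.span ℝ (a '' I) ≤ (ℝ ∙ (p - q))ᗮ := by
    rw [Submodule.span_le]
    rintro _ ⟨j, hj, rfl⟩
    rw [SetLike.mem_coe, Submodule.mem_orthogonal_singleton_iff_inner_left, inner_sub_right, h j hj,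
      sub_self]
  rw [← sub_eq_zero, ← map_sub, Submodule.starProjection_apply_eq_zero_iff]
  exact (Submodule.mem_orthogonal _ _).2 fun v hv =>
    Submodule.mem_orthogonal_singleton_iff_inner_left.1 (hle hv)

end Polyhedral

end RelaxedProjections

/-! ### Reduction of polyhedral projections to affine steps. -/

open RelaxedProjections in
theorem theorem3p2 {X : Type*} [NormedAddCommGroup X] [InnerProductSpace ℝ X] [CompleteSpace X]
    (𝒞 : Set (Set X)) (h𝒞_finite : 𝒞.Finite) (h𝒞_nonempty : 𝒞.Nonempty)
    (h𝒞 : ∀ C ∈ 𝒞, C.Nonempty ∧ RelaxedProjections.IsPolyhedral C)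
    (lam : ℝ) (hlam : lam ∈ Set.Ico (0 : ℝ) 2) (x₀ : X)
    (x : ℕ → X) (hx_zero : x 0 = x₀)
    (hx_succ : ∀ n : ℕ, ∃ R ∈ RelaxedProjections.relaxedProjectors 𝒞 (Set.Icc 0 lam),
      x (n + 1) = R (x n)) :
    Bornology.IsBounded (Set.range x) := by
  classical
  choose! S hSfin hS hCS using fun C hC => (h𝒞 C hC).2
  have hhalf : ∀ H ∈ ⋃ C ∈ 𝒞, S C, IsClosedHalfspace H := by
    intro H hH
    obtain ⟨C, hC, hH⟩ := Set.mem_iUnion₂.1 hH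
    exact hS C hC H hH
  choose! a _ β hβ using hhalf
  have hfin : (⋃ C ∈ 𝒞, S C).Finite := h𝒞_finite.biUnion hSfin
  let W : Finset (Set X) → Submodule ℝ X := fun I => Submodule.span ℝ (a '' (I : Set (Set X)))
  have hW : ∀ I, FiniteDimensional ℝ (W I) := fun I =>
    FiniteDimensional.span_of_finite ℝ (I.finite_toSet.image a)
  have hex : ∀ I : Finset (Set X), ∃ b ∈ W I, ∀ p : X, (∀ H ∈ I, inner ℝ (a H) p = β H) →
      (W I).starProjection p = b := by
    intro I
    by_cases h : ∃ q : X, ∀ H ∈ I, inner ℝ (a H) q = β H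
    · obtain ⟨q, hq⟩ := h
      exact ⟨_, (W I).starProjection_apply_mem q, fun p hp =>
        starProjection_span_eq _ a fun H hH => (hp H hH).trans (hq H hH).symm⟩
    -- Inconsistent equations get the harmless default 0: an active set always has its nearest point
    -- as a solution.
    · exact ⟨0, (W I).zero_mem, fun p hp => absurd ⟨p, hp⟩ h⟩
  choose b hbW hb using hex
  have hstep : ∀ n, AffineStep W b lam hfin.toFinset.powerset (x n) (x (n + 1)) := by
    intro n
    obtain ⟨R, ⟨C, hC, μ, hμ, rfl⟩, hR⟩ := hx_succ n
    have hpoly := (h𝒞 C hC).2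
    have hp := (projector_eq_iff (h𝒞 C hC).1 hpoly.isClosed hpoly.convex (x n) _).1 rfl
    set p := projector C (x n) with hpdef
    have hCeq : C = {z | ∀ H ∈ (hSfin C hC).toFinset, inner ℝ (a H) z ≤ β H} := by
      ext z
      conv_lhs => rw [hCS C hC]
      simp only [Set.mem_sInter, Set.Finite.mem_toFinset, Set.mem_ofPred_eq]
      refine forall₂_congr fun H hH => ?_
      conv_lhs => rw [hβ H (Set.mem_iUnion₂.2 ⟨C, hC, hH⟩)]
      rfl
    rw [hCeq] at hp
    have hmem := sub_mem_span_of_isNearestPoint _ a β hp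
    set I := (hSfin C hC).toFinset.filter fun H => inner ℝ (a H) p = β H with hI
    have hmem' : x n - p ∈ W I := by
      simpa only [W, hI, Finset.coe_filter] using hmem
    refine ⟨I, ?_, μ, hμ, ?_⟩
    · refine Finset.mem_powerset.2 fun H hH => ?_
      have := (Finset.mem_filter.1 hH).1
      exact hfin.mem_toFinset.2 (Set.mem_iUnion₂.2 ⟨C, hC, (hSfin C hC).mem_toFinset.1 this⟩)
    · have e : (W I).starProjection (x n) - b I = x n - p := by
        rw [← hb I p fun H hH => (Finset.mem_filter.1 hH).2, ← map_sub]
        exact Submodule.starProjection_eq_self_iff.2 hmem'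
      rw [hR, e]
      module
  obtain ⟨K, hK⟩ := exists_norm_le_of_reachable hlam.2 _ (fun I _ => hbW I) (x 0)
  refine isBounded_iff_forall_norm_le.2 ⟨K, ?_⟩
  rintro _ ⟨n, rfl⟩
  refine hK _ ?_
  induction n with
  | zero => exact .refl
  | succ n ih => exact ih.tail (hstep n)
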